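/- Let $d\ge 2$ be an integer and let $2^*=\infty$ if $d=2$, $2^*=\frac{2d}{d-2}$ if $d\ge 3$. For $\varepsilon>0$ let $\mathcal G_\varepsilon^d\subset\mathbb R^d$ be the cubic metric grid with vertex set $\varepsilon\mathbb Z^d$ whose edges are the segments of length $\varepsilon$ joining two vertices at distance $\varepsilon$ (each segment counted once). Let $L^q(\mathcal G_\varepsilon^d)$ be taken with respect to arc length on the edges, and let $H^1(\mathcal G_\varepsilon^d)$ be the space of continuous functions $u:\mathcal G_\varepsilon^d\to\mathbb R$ whose restriction to every edge is in $H^1$ of that edge and for which $\|u\|_{L^2(\mathcal G_\varepsilon^d)}$ and $\|u'\|_{L^2(\mathcal G_\varepsilon^d)}$ are finite, $u'$ being the derivative along the edges. For $p\in(2,2^*)$ and $\omega>0$ put $$\tilde{\mathcal J}_{\omega,\mathcal G_\varepsilon^d}(u)=\frac12\|u'\|_{L^2(\mathcal G_\varepsilon^d)}^2+\frac{\omega}{2d}\|u\|_{L^2(\mathcal G_\varepsilon^d)}^2-\frac1{dp}\|u\|_{L^p(\mathcal G_\varepsilon^d)}^p ,\qquad u\in H^1(\mathcal G_\varepsilon^d),$$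 $$\tilde{\mathcal N}_{\omega,\mathcal G_\varepsilon^d}=\Bigl\{u\in H^1(\mathcal G_\varepsilon^d)\setminus\{0\}:\ d\,\|u'\|_{L^2(\mathcal G_\varepsilon^d)}^2+\omega\|u\|_{L^2(\mathcal G_\varepsilon^d)}^2=\|u\|_{L^p(\mathcal G_\varepsilon^d)}^p\Bigr\}.$$ An action ground state on $\mathcal G_\varepsilon^d$ is a function $u\in\tilde{\mathcal N}_{\omega,\mathcal G_\varepsilon^d}$ with $\tilde{\mathcal J}_{\omega,\mathcal G_\varepsilon^d}(u)=\inf_{v\in\tilde{\mathcal N}_{\omega,\mathcal G_\varepsilon^d}}\tilde{\mathcal J}_{\omega,\mathcal G_\varepsilon^d}(v)$. **Theorem.** For every $p\in(2,2^*)$ and $\omega>0$ there exist $\bar\varepsilon>0$ and $C>0$, depending only on $p$, $\omega$ and $d$, such that for every $\varepsilon\in(0,\bar\varepsilon)$ and every action ground state $u$ on $\mathcal G_\varepsilon^d$, $$\frac1C\le\varepsilon^{d-1}\|u'\|_{L^2(\mathcal G_\varepsilon^d)}^2\le C,\qquad \frac1C\le\varepsilon^{d-1}\|u\|_{L^2(\mathcal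 G_\varepsilon^d)}^2\le C,\qquad \frac1C\le\varepsilon^{d-1}\|u\|_{L^p(\mathcal G_\varepsilon^d)}^p\le C .$$ -/

import Mathlib

open MeasureTheory Set

noncomputable section

namespace CubicGrid

/-- The critical Sobolev exponent `2^*` in dimension `d ≥ 2`: it is `∞` if `d = 2` and
`2d / (d - 2)` if `d ≥ 3`. -/
def criticalExponent (d : ℕ) : EReal :=
  if d = 2 then ⊤ else ((2 * (d : ℝ) / ((d : ℝ) - 2) : ℝ) : EReal)

/-- The edges of the cubic grid. The pair `(k, i)` stands for the edge that joins the vertices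
`ε k` and `ε (k + e_i)`, with `k ∈ ℤ^d` and `e_i` the `i`-th vector of the standard basis. Every
unordered pair of points of `ε ℤ^d` at distance `ε` is obtained exactly once. -/
abbrev Edge (d : ℕ) : Type := (Fin d → ℤ) × Fin d

/-- The point `ε k + t e_i`. For `0 ≤ t ≤ ε` this is the arc length parametrization of the edge
`e = (k, i)` of the grid with edgelength `ε`. -/
def edgePoint {d : ℕ} (ε : ℝ) (e : Edge d) (t : ℝ) : EuclideanSpace ℝ (Fin d) :=
  WithLp.toLp 2 fun j => ε * (e.1 j : ℝ) + if j = e.2 then t else 0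

/-- The `d`-dimensional cubic grid with edgelength `ε`, as a subset of `ℝ^d`: the union of all
its (closed) edges. -/
def grid (d : ℕ) (ε : ℝ) : Set (EuclideanSpace ℝ (Fin d)) :=
  {x | ∃ e : Edge d, ∃ t ∈ Icc (0 : ℝ) ε, edgePoint ε e t = x}

open Classical in
/-- The restriction of `u` to the edge `e`, as a function of the arc length `t ∈ [0, ε]`
(and `0` for `t` outside `[0, ε]`, where its values play no role). -/
def onEdge {d : ℕ} {ε : ℝ} (u : grid d ε → ℝ) (e : Edge d) (t : ℝ) : ℝ :=
  if h : t ∈ Icc (0 : ℝ) ε then u ⟨edgePoint ε e t, e, t, h, rfl⟩ else 0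

/-- `‖u‖_{L^q}^q` on the grid: the sum over all edges of `∫ |u|^q`. -/
def lpNormPow {d : ℕ} {ε : ℝ} (q : ℝ) (u : grid d ε → ℝ) : ℝ :=
  ∑' e : Edge d, ∫ t in (0 : ℝ)..ε, |onEdge u e t| ^ q

/-- `‖u'‖_{L^2}^2` on the grid: the sum over all edges of `∫ |u'|^2`, the derivative being taken
with respect to the arc length. -/
def derivNormSq {d : ℕ} {ε : ℝ} (u : grid d ε → ℝ) : ℝ :=
  ∑' e : Edge d, ∫ t in (0 : ℝ)..ε, |deriv (onEdge u e) t| ^ (2 : ℝ)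

/-- The Sobolev space `H^1` of the grid: the continuous functions `u` on the grid whose
restriction to every edge is in `H^1(0, ε)` (that is, absolutely continuous with square integrable
derivative), with `‖u‖_{L^2}` and `‖u'‖_{L^2}` finite. -/
structure MemH1 {d : ℕ} {ε : ℝ} (u : grid d ε → ℝ) : Prop where
  continuous : Continuous u
  absolutelyContinuous : ∀ e : Edge d, AbsolutelyContinuousOnInterval (onEdge u e) 0 ε
  memLp_deriv : ∀ e : Edge d, MemLp (deriv (onEdge u e)) 2 (volume.restrict (Ioo 0 ε))
  summable_sq : Summable fun e : Edge d => ∫ t in (0 : ℝ)..ε, |onEdge u e t| ^ (2 : ℝ)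
  summable_deriv_sq :
    Summable fun e : Edge d => ∫ t in (0 : ℝ)..ε, |deriv (onEdge u e) t| ^ (2 : ℝ)

/-- The action functional
`u ↦ (1/2) ‖u'‖_2^2 + (ω/(2d)) ‖u‖_2^2 - (1/(dp)) ‖u‖_p^p`. For `u` in `H^1` and `p ≥ 2` all the
series in it converge. -/
def action {d : ℕ} {ε : ℝ} (p ω : ℝ) (u : grid d ε → ℝ) : ℝ :=
  1 / 2 * derivNormSq u + ω / (2 * (d : ℝ)) * lpNormPow 2 u - 1 / ((d : ℝ) * p) * lpNormPow p u

/-- The Nehari manifold: the nonzero `u` in `H^1` with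
`d ‖u'‖_2^2 + ω ‖u‖_2^2 = ‖u‖_p^p`. -/
def nehari (d : ℕ) (ε p ω : ℝ) : Set (grid d ε → ℝ) :=
  {u | MemH1 u ∧ u ≠ 0 ∧ (d : ℝ) * derivNormSq u + ω * lpNormPow 2 u = lpNormPow p u}

/-- The action ground state level: the infimum of the action on the Nehari manifold. -/
def groundStateLevel (d : ℕ) (ε p ω : ℝ) : ℝ :=
  sInf (action p ω '' nehari d ε p ω)

/-- `u` is an action ground state: it lies on the Nehari manifold and attains the infimum of the
action there. -/
def IsGroundState {d : ℕ} {ε : ℝ} (p ω : ℝ) (u : grid d ε → ℝ) : Prop :=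
  u ∈ nehari d ε p ω ∧ action p ω u = groundStateLevel d ε p ω

/-- The action is bounded below on the Nehari manifold, so that the ground state level is a
genuine infimum. -/
theorem bddBelow_action {d : ℕ} {ε p ω : ℝ} (hd : 2 ≤ d) (hε : 0 < ε) (hp : 2 < p) :
    BddBelow (action p ω '' nehari d ε p ω) := by
  refine ⟨0, ?_⟩
  rintro _ ⟨u, ⟨-, -, hu⟩, rfl⟩
  have hd0 : (0 : ℝ) < d := by exact_mod_cast (by omega : 0 < d)
  have hL : 0 ≤ lpNormPow p u := tsum_nonneg fun e =>
    intervalIntegral.integral_nonneg hε.le fun t _ => by positivity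
  have h : action p ω u = (1 / 2 - 1 / p) / d * lpNormPow p u := by
    unfold action
    rw [← hu]
    have : p ≠ 0 := by linarith
    field_simp
  rw [h]
  have h2 : 1 / p ≤ 1 / 2 := by
    apply one_div_le_one_div_of_le <;> linarith
  have h3 : 0 ≤ 1 / 2 - 1 / p := by linarith
  positivity

end CubicGrid

end

noncomputable section

namespace CubicGrid

open Filter Topology Function
open scoped NNReal ENNReal

/-! ### Absolutely continuous functions -/

/-! Write `A`, `B`, `P` for `ε^(d-1)` times `‖u'‖_2^2`, `‖u‖_2^2`, `‖u‖_p^p`. The Nehari identity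
reads `d A + ω B = P`, and everything follows from two facts uniform in `ε`: an upper bound on `P`,
and `P ≤ K A^α B^β` with `α, β > 0` and `α + β > 1`. Indeed `A` and `B` are at most constants times
`P`, so `P ≤ L P^(α+β)` keeps `P` away from `0`; then `P ≤ K A^α B^β`, with one factor bounded
above, bounds the other below (`bounds_of_gagliardo_nirenberg`).

Upper bound: on the Nehari manifold the action is a positive multiple of `‖u‖_p^p`, so a ground
state minimizes this norm. A fixed tent on `ℝ^d`, restricted to the grid and rescaled onto the
manifold, is a competitor: it meets about `ε^(-d)` edges of length `ε`, so its scaled norms are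
bounded above and below (`exists_mem_nehari_lpNormPow_le`).

Interpolation inequality: this is Gagliardo's proof of the Sobolev inequality carried out on the
grid. The value of `|u|^s` at a point is controlled by the integral of `s |u|^(s-1) |u'|` over the
edges issuing from a lattice line, in each of the `d` directions; multiplying the `d` bounds and
applying the discrete Loomis-Whitney inequality gives `grid_sobolev`. The weight `ε^(d-1)` is
exactly the one that removes `ε` from the constant. Cauchy-Schwarz, interpolation and absorption
then give `gagliardo_nirenberg`. -/

theorem _root_.LipschitzOnWith.comp_absolutelyContinuousOnInterval {g f : ℝ → ℝ} {K : ℝ≥0}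
    {s : Set ℝ} {a b : ℝ} (hg : LipschitzOnWith K g s) (hf : AbsolutelyContinuousOnInterval f a b)
    (hs : MapsTo f (uIcc a b) s) : AbsolutelyContinuousOnInterval (fun t => g (f t)) a b := by
  unfold AbsolutelyContinuousOnInterval at hf ⊢
  refine squeeze_zero' (Eventually.of_forall fun _ => Finset.sum_nonneg fun _ _ => dist_nonneg) ?_
    (by simpa using hf.const_mul (K : ℝ))
  rw [eventually_inf_principal]
  filter_upwards with E hE
  rw [Finset.mul_sum]
  refine Finset.sum_le_sum fun i hi => ?_
  exact hg.dist_le_mul _ (hs (hE.1 i hi).1) _ (hs (hE.1 i hi).2)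

theorem abs_deriv_abs_rpow {s : ℝ} (hs : 1 < s) (x : ℝ) :
    |s * |x| ^ (s - 2) * x| = s * |x| ^ (s - 1) := by
  rw [abs_mul, abs_mul, abs_of_pos (by linarith : 0 < s), abs_of_nonneg (by positivity), mul_assoc]
  rcases eq_or_ne x 0 with rfl | h0
  · simp [Real.zero_rpow (sub_pos.2 hs).ne']
  · rw [← Real.rpow_add_one (abs_pos.2 h0).ne', show s - 2 + 1 = s - 1 by ring]

theorem lipschitzOnWith_abs_rpow {s : ℝ} (hs : 1 < s) (C : ℝ≥0) :
    LipschitzOnWith (Real.toNNReal (s * (C : ℝ) ^ (s - 1))) (fun x : ℝ => |x| ^ s)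
      (Icc (-C : ℝ) C) := by
  refine (convex_Icc _ _).lipschitzOnWith_of_nnnorm_hasDerivWithin_le
    (f' := fun x => s * |x| ^ (s - 2) * x)
    (fun x _ => (hasDerivAt_abs_rpow x hs).hasDerivWithinAt) fun x hx => ?_
  rw [← NNReal.coe_le_coe, coe_nnnorm, Real.coe_toNNReal _ (by positivity), Real.norm_eq_abs,
    abs_deriv_abs_rpow hs]
  gcongr
  exact abs_le.2 hx

/-- The variation of `|f|^s` along an interval is at most `∫ s |f|^(s-1) |f'|`. -/
theorem enorm_rpow_le_add_lintegral {f : ℝ → ℝ} {a b s : ℝ} (hs : 1 < s)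
    (hab : a ≤ b) (hf : AbsolutelyContinuousOnInterval f a b) {x y : ℝ} (hx : x ∈ Icc a b)
    (hy : y ∈ Icc a b) :
    ‖f x‖ₑ ^ s ≤ ‖f y‖ₑ ^ s +
      ∫⁻ t in Ioc a b, ENNReal.ofReal s * (‖f t‖ₑ ^ (s - 1) * ‖deriv f t‖ₑ) := by
  have hs0 : 0 ≤ s := by linarith
  obtain ⟨C, hC⟩ := hf.exists_bound
  have hC0 : 0 ≤ C := (norm_nonneg _).trans (hC a left_mem_uIcc)
  lift C to ℝ≥0 using hC0
  -- `|·|^s` is Lipschitz only on bounded sets, hence the bound `C` on `f`; the fundamental theorem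
  -- of calculus then applies to `|f|^s`.
  have hg : AbsolutelyContinuousOnInterval (fun t => |f t| ^ s) a b :=
    (lipschitzOnWith_abs_rpow hs C).comp_absolutelyContinuousOnInterval hf
      fun t ht => abs_le.1 (hC t ht)
  have hsub : uIoc y x ⊆ Ioc a b := by
    intro t ht
    rcases mem_uIoc.1 ht with h | h
    · exact ⟨hy.1.trans_lt h.1, h.2.trans hx.2⟩
    · exact ⟨hx.1.trans_lt h.1, h.2.trans hy.2⟩
  have hsub' : uIcc y x ⊆ uIcc a b := by
    rw [uIcc_of_le hab]; exact uIcc_subset_Icc hy hx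
  have hderiv : ∀ᵐ t, t ∈ Ioc a b → ‖deriv (fun t => |f t| ^ s) t‖ₑ =
      ENNReal.ofReal s * (‖f t‖ₑ ^ (s - 1) * ‖deriv f t‖ₑ) := by
    filter_upwards [hf.ae_differentiableAt] with t ht htm
    have h1 := (ht (by rw [uIcc_of_le hab]; exact Ioc_subset_Icc_self htm)).hasDerivAt
    have h2 := (hasDerivAt_abs_rpow (f t) hs).comp t h1
    have h3 : deriv (fun t => |f t| ^ s) t = s * |f t| ^ (s - 2) * f t * deriv f t := h2.deriv
    rw [h3, enorm_mul, ← mul_assoc, ← Real.enorm_abs (s * _ * _), abs_deriv_abs_rpow hs, enorm_mul,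
      Real.enorm_rpow_of_nonneg (abs_nonneg _) (by linarith), Real.enorm_abs,
      Real.enorm_of_nonneg hs0]
  have key : ‖|f x| ^ s - |f y| ^ s‖ₑ ≤
      ∫⁻ t in Ioc a b, ENNReal.ofReal s * (‖f t‖ₑ ^ (s - 1) * ‖deriv f t‖ₑ) := by
    rw [← (hg.mono hsub').integral_deriv_eq_sub]
    calc _ ≤ ∫⁻ t in uIoc y x, ‖deriv (fun t => |f t| ^ s) t‖ₑ := by
          rw [← ofReal_norm, intervalIntegral.norm_integral_eq_norm_integral_uIoc, ofReal_norm]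
          exact enorm_integral_le_lintegral_enorm _
      _ ≤ ∫⁻ t in Ioc a b, ‖deriv (fun t => |f t| ^ s) t‖ₑ := lintegral_mono_set hsub
      _ = _ := setLIntegral_congr_fun_ae measurableSet_Ioc hderiv
  have e : ∀ z : ℝ, ‖z‖ₑ ^ s = ‖|z| ^ s‖ₑ := fun z => by
    rw [Real.enorm_rpow_of_nonneg (abs_nonneg _) hs0, Real.enorm_abs]
  rw [e, e]
  calc ‖|f x| ^ s‖ₑ = ‖|f y| ^ s + (|f x| ^ s - |f y| ^ s)‖ₑ := by congr 1; ring
    _ ≤ ‖|f y| ^ s‖ₑ + ‖|f x| ^ s - |f y| ^ s‖ₑ := enorm_add_le _ _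
    _ ≤ _ := by gcongr

/-! ### Sobolev and Gagliardo-Nirenberg inequalities -/

/-- Interpolation of `∫ U^r` between `∫ U^2` and `∫ U^q`. -/
theorem lintegral_rpow_interpolate {X : Type*} [MeasurableSpace X] {ν : Measure X}
    {U : X → ℝ≥0∞} (hU : AEMeasurable U ν) {q θ : ℝ} (hq : 0 ≤ q) (hθ : 0 ≤ θ) (hθ1 : θ ≤ 1) :
    ∫⁻ x, U x ^ (2 * θ + q * (1 - θ)) ∂ν ≤
      (∫⁻ x, U x ^ (2 : ℝ) ∂ν) ^ θ * (∫⁻ x, U x ^ q ∂ν) ^ (1 - θ) := by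
  have h1 : 0 ≤ 1 - θ := by linarith
  refine le_trans (le_of_eq ?_) (ENNReal.lintegral_mul_norm_pow_le (hU.pow_const 2)
    (hU.pow_const q) hθ h1 (by ring))
  refine lintegral_congr fun x => ?_
  rw [← ENNReal.rpow_mul, ← ENNReal.rpow_mul, ENNReal.rpow_add_of_nonneg _ _ (by positivity)
    (by positivity)]

/-- A Sobolev inequality for `|u|^s`, from `W^{1,1}` to `L^m`, implies a Gagliardo-Nirenberg
inequality. -/
theorem lintegral_rpow_le_of_sobolev {X : Type*} [MeasurableSpace X] {ν : Measure X}
    {U V : X → ℝ≥0∞} (hU : AEMeasurable U ν) (hV : AEMeasurable V ν) {m p q s θ η δ : ℝ}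
    {C : ℝ≥0∞} (hm : 0 ≤ m) (hq : 0 ≤ q) (hθ : 0 ≤ θ) (hθ1 : θ ≤ 1)
    (hs' : 2 * (s - 1) = 2 * θ + q * (1 - θ)) (hη : 0 ≤ η) (hη1 : η ≤ 1)
    (hp : p = 2 * η + q * (1 - η)) (hδ : δ = 1 - (1 - θ) * (m / 2)) (hδ0 : 0 < δ)
    (hS : ∫⁻ x, U x ^ q ∂ν ≤ C * (∫⁻ x, U x ^ (s - 1) * V x ∂ν) ^ m)
    (hfin : ∫⁻ x, U x ^ q ∂ν ≠ ⊤) :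
    ∫⁻ x, U x ^ p ∂ν ≤ C ^ ((1 - η) / δ) *
      (∫⁻ x, V x ^ (2 : ℝ) ∂ν) ^ (m / 2 * ((1 - η) / δ)) *
      (∫⁻ x, U x ^ (2 : ℝ) ∂ν) ^ (η + θ * (m / 2) * ((1 - η) / δ)) := by
  set Q := ∫⁻ x, U x ^ q ∂ν with hQ
  set A := ∫⁻ x, V x ^ (2 : ℝ) ∂ν with hA
  set B := ∫⁻ x, U x ^ (2 : ℝ) ∂ν with hB
  have h1θ : 0 ≤ 1 - θ := by linarith
  have h1η : 0 ≤ 1 - η := by linarith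
  -- Cauchy-Schwarz, then `U^(2(s-1))` is interpolated between `U^2` and `U^q`, so that `Q`
  -- reappears with a smaller power.
  have hCS : ∫⁻ x, U x ^ (s - 1) * V x ∂ν ≤ (B ^ θ * Q ^ (1 - θ)) ^ (1 / 2 : ℝ) * A ^ (1 / 2 : ℝ) := by
    calc ∫⁻ x, U x ^ (s - 1) * V x ∂ν
        = ∫⁻ x, (U x ^ (2 * (s - 1))) ^ (1 / 2 : ℝ) * (V x ^ (2 : ℝ)) ^ (1 / 2 : ℝ) ∂ν := by
          refine lintegral_congr fun x => ?_
          rw [← ENNReal.rpow_mul, ← ENNReal.rpow_mul, show 2 * (s - 1) * (1 / 2) = s - 1 by ring,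
            show (2 : ℝ) * (1 / 2) = 1 by norm_num, ENNReal.rpow_one]
      _ ≤ (∫⁻ x, U x ^ (2 * (s - 1)) ∂ν) ^ (1 / 2 : ℝ) * A ^ (1 / 2 : ℝ) :=
          ENNReal.lintegral_mul_norm_pow_le (hU.pow_const _) (hV.pow_const _) (by norm_num)
            (by norm_num) (by norm_num)
      _ ≤ _ := by
          gcongr
          rw [hs']
          exact lintegral_rpow_interpolate hU hq hθ hθ1
  have hQ1 : Q ≤ C * A ^ (m / 2) * B ^ (θ * (m / 2)) * Q ^ ((1 - θ) * (m / 2)) := by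
    calc Q ≤ C * ((B ^ θ * Q ^ (1 - θ)) ^ (1 / 2 : ℝ) * A ^ (1 / 2 : ℝ)) ^ m := by
          refine hS.trans ?_
          gcongr
      _ = _ := by
          rw [ENNReal.mul_rpow_of_nonneg _ _ hm, ← ENNReal.rpow_mul, ← ENNReal.rpow_mul,
            show 1 / 2 * m = m / 2 by ring, ENNReal.mul_rpow_of_nonneg _ _ (by positivity),
            ← ENNReal.rpow_mul, ← ENNReal.rpow_mul]
          ring
  -- Absorption of the power of `Q` on the right, of exponent `1 - δ < 1`; this is where `Q` must be
  -- finite.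
  have hQδ : Q ^ δ ≤ C * A ^ (m / 2) * B ^ (θ * (m / 2)) := by
    rcases eq_or_ne Q 0 with h0 | h0
    · rw [h0, ENNReal.zero_rpow_of_pos hδ0]; exact zero_le
    · have hpos : Q ^ ((1 - θ) * (m / 2)) ≠ 0 := by
        simp [ENNReal.rpow_eq_zero_iff, h0, hfin]
      have htop : Q ^ ((1 - θ) * (m / 2)) ≠ ⊤ := ENNReal.rpow_ne_top_of_nonneg (by positivity) hfin
      rw [← ENNReal.mul_le_mul_iff_left hpos htop, ← ENNReal.rpow_add _ _ h0 hfin, hδ]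
      simpa using hQ1
  have hQ2 : Q ^ (1 - η) ≤ (C * A ^ (m / 2) * B ^ (θ * (m / 2))) ^ ((1 - η) / δ) := by
    rw [show 1 - η = δ * ((1 - η) / δ) by field_simp, ENNReal.rpow_mul,
      mul_div_cancel₀ _ hδ0.ne']
    gcongr
  have hκ : 0 ≤ (1 - η) / δ := by positivity
  calc ∫⁻ x, U x ^ p ∂ν ≤ B ^ η * Q ^ (1 - η) := by
        rw [hp]; exact lintegral_rpow_interpolate hU hq hη hη1
    _ ≤ B ^ η * (C * A ^ (m / 2) * B ^ (θ * (m / 2))) ^ ((1 - η) / δ) := by gcongr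
    _ = _ := by
        rw [ENNReal.mul_rpow_of_nonneg _ _ hκ, ENNReal.mul_rpow_of_nonneg _ _ hκ,
          ← ENNReal.rpow_mul, ← ENNReal.rpow_mul, ENNReal.rpow_add_of_nonneg _ _ hη (by positivity)]
        ring

/-! ### The discrete Loomis-Whitney inequality -/

theorem pi_count_int (d : ℕ) :
    Measure.pi (fun _ : Fin d => (Measure.count : Measure ℤ)) = Measure.count := by
  refine Measure.ext_of_singleton fun k => ?_
  rw [Measure.pi_singleton]
  simp

/-- The measure-theoretic inequality behind Gagliardo's argument, taken for counting measure on each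
factor `ℤ`. -/
theorem tsum_prod_tsum_rpow_le {d : ℕ} (hd : 2 ≤ d) (f : (Fin d → ℤ) → ℝ≥0∞) :
    ∑' k, ∏ j, (∑' n : ℤ, f (update k j n)) ^ (1 / ((d : ℝ) - 1)) ≤
      (∑' k, f k) ^ ((d : ℝ) / (d - 1)) := by
  have hd1 : (1 : ℝ) < d := by exact_mod_cast hd
  have h := lintegral_prod_lintegral_pow_le (ι := Fin d) (A := fun _ => ℤ)
    (fun _ => Measure.count) (p := (d : ℝ) / (d - 1))
    (by simpa [Real.conjExponent] using Real.HolderConjugate.conjExponent hd1) (f := f) (measurable_of_countable f)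
  simpa [pi_count_int, lintegral_count, Fintype.card_fin] using h

/-- Telescoping along the ray from `k` in direction `j`; the boundary term at infinity vanishes by
`hlim`. -/
theorem le_tsum_line {d : ℕ} {w f : (Fin d → ℤ) → ℝ≥0∞} {j : Fin d}
    (hstep : ∀ k, w k ≤ w (update k j (k j + 1)) + f k) (k : Fin d → ℤ)
    (hlim : Tendsto (fun N : ℕ => w (update k j (k j + N))) atTop (𝓝 0)) :
    w k ≤ ∑' n : ℤ, f (update k j n) := by
  have h : ∀ N : ℕ, w k ≤ w (update k j (k j + N)) +
      ∑ n ∈ Finset.range N, f (update k j (k j + n)) := by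
    intro N
    induction N with
    | zero => simp
    | succ N ih =>
      refine ih.trans ?_
      rw [Finset.sum_range_succ, add_comm (∑ n ∈ _, _), ← add_assoc]
      gcongr
      simpa [add_assoc] using hstep (update k j (k j + N))
  have h2 : ∀ N : ℕ, w k ≤ w (update k j (k j + N)) + ∑' n : ℤ, f (update k j n) := fun N => by
    refine (h N).trans ?_
    gcongr
    refine (ENNReal.sum_le_tsum _).trans ?_
    exact ENNReal.tsum_comp_le_tsum_of_injective (f := fun n : ℕ => k j + (n : ℤ))
      (fun a b hab => by simpa using hab) (fun n => f (update k j n))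
  simpa using ge_of_tendsto' (hlim.add_const _) h2

/-! ### The grid as a measure space -/

theorem edgePoint_zero {d : ℕ} (ε : ℝ) (k : Fin d → ℤ) (i j : Fin d) :
    edgePoint ε (k, i) 0 = edgePoint ε (k, j) 0 := by
  simp [edgePoint]

theorem edgePoint_end {d : ℕ} (ε : ℝ) (k : Fin d → ℤ) (i j : Fin d) :
    edgePoint ε (k, i) ε = edgePoint ε (update k i (k i + 1), j) 0 := by
  unfold edgePoint
  congr 1
  ext l
  by_cases h : l = i
  · subst h; simp; ring
  · simp [h]

variable {d : ℕ} {ε : ℝ}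

theorem continuous_edgePoint (ε : ℝ) (e : Edge d) : Continuous (edgePoint ε e) := by
  unfold edgePoint
  refine (PiLp.continuous_toLp 2 _).comp (continuous_pi fun j => ?_)
  by_cases h : j = e.2 <;> simp [h] <;> fun_prop

theorem onEdge_of_mem (u : grid d ε → ℝ) (e : Edge d) {t : ℝ} (ht : t ∈ Icc 0 ε) :
    onEdge u e t = u ⟨edgePoint ε e t, e, t, ht, rfl⟩ := dif_pos ht

theorem onEdge_zero (hε : 0 ≤ ε) (u : grid d ε → ℝ) (k : Fin d → ℤ) (i j : Fin d) :
    onEdge u (k, i) 0 = onEdge u (k, j) 0 := by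
  rw [onEdge_of_mem _ _ (left_mem_Icc.2 hε), onEdge_of_mem _ _ (left_mem_Icc.2 hε)]
  congr 1
  exact Subtype.ext (edgePoint_zero ε k i j)

/-- With `onEdge_zero`, the gluing at vertices that lets estimates pass from one edge to the next.
-/
theorem onEdge_end (hε : 0 ≤ ε) (u : grid d ε → ℝ) (k : Fin d → ℤ) (i j : Fin d) :
    onEdge u (k, i) ε = onEdge u (update k i (k i + 1), j) 0 := by
  rw [onEdge_of_mem _ _ (left_mem_Icc.2 hε), onEdge_of_mem _ _ (right_mem_Icc.2 hε)]
  congr 1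
  exact Subtype.ext (edgePoint_end ε k i j)

theorem measurable_onEdge {u : grid d ε → ℝ} (hu : Continuous u) (e : Edge d) :
    Measurable (onEdge u e) := by
  classical
  have : Continuous fun t : Icc (0 : ℝ) ε =>
      u ⟨edgePoint ε e t, e, t, t.2, rfl⟩ :=
    hu.comp (((continuous_edgePoint ε e).comp continuous_subtype_val).subtype_mk _)
  have h := Measurable.dite (s := Icc (0 : ℝ) ε) this.measurable
    (g := fun _ => (0 : ℝ)) measurable_const measurableSet_Icc
  exact h

/-- Arc length on the edges of the grid, times `ε^(d-1)`. -/
def gridMeasure (d : ℕ) (ε : ℝ) : Measure (Edge d × ℝ) :=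
  ENNReal.ofReal (ε ^ (d - 1)) • Measure.count.prod (volume.restrict (Ioc 0 ε))

theorem lintegral_gridMeasure {f : Edge d × ℝ → ℝ≥0∞} (hf : Measurable f) :
    ∫⁻ x, f x ∂gridMeasure d ε =
      ENNReal.ofReal (ε ^ (d - 1)) * ∑' e : Edge d, ∫⁻ t in Ioc 0 ε, f (e, t) := by
  rw [gridMeasure, lintegral_smul_measure, lintegral_prod _ hf.aemeasurable, lintegral_count,
    smul_eq_mul]

theorem measurable_enorm_onEdge {u : grid d ε → ℝ} (hu : Continuous u) :
    Measurable fun x : Edge d × ℝ => ‖onEdge u x.1 x.2‖ₑ :=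
  measurable_from_prod_countable_right fun e => (measurable_onEdge hu e).enorm

theorem measurable_enorm_deriv_onEdge (u : grid d ε → ℝ) :
    Measurable fun x : Edge d × ℝ => ‖deriv (onEdge u x.1) x.2‖ₑ :=
  measurable_from_prod_countable_right fun e => (measurable_deriv (onEdge u e)).enorm

theorem intervalIntegral_abs_rpow_eq (hε : 0 ≤ ε) {g : ℝ → ℝ} (hg : Measurable g) {q : ℝ}
    (hq : 0 ≤ q) :
    ∫ t in (0 : ℝ)..ε, |g t| ^ q = (∫⁻ t in Ioc 0 ε, ‖g t‖ₑ ^ q).toReal := by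
  rw [intervalIntegral.integral_of_le hε, integral_eq_lintegral_of_nonneg_ae
    (Eventually.of_forall fun t => by positivity)
    (by measurability)]
  congr 1
  refine lintegral_congr fun t => ?_
  rw [← Real.enorm_of_nonneg (by positivity), Real.enorm_rpow_of_nonneg (abs_nonneg _) hq,
    Real.enorm_abs]

theorem lintegral_enorm_deriv_ne_top {u : grid d ε → ℝ} (hu : MemH1 u) (e : Edge d) :
    ∫⁻ t in Ioc 0 ε, ‖deriv (onEdge u e) t‖ₑ ^ (2 : ℝ) ≠ ⊤ := by
  have h := (hu.memLp_deriv e).2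
  rw [eLpNorm_lt_top_iff_lintegral_rpow_enorm_lt_top (by norm_num) (by norm_num)] at h
  rw [← restrict_Ioo_eq_restrict_Ioc]
  simpa using h.ne

theorem lintegral_enorm_onEdge_ne_top (hε : 0 ≤ ε) {u : grid d ε → ℝ} (hu : MemH1 u) (e : Edge d)
    {q : ℝ} (hq : 0 ≤ q) : ∫⁻ t in Ioc 0 ε, ‖onEdge u e t‖ₑ ^ q ≠ ⊤ := by
  obtain ⟨C, hC⟩ := (hu.absolutelyContinuous e).exists_bound
  refine ne_top_of_le_ne_top ?_ (setLIntegral_mono (g := fun _ => ENNReal.ofReal C ^ q)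
    measurable_const fun t ht => ?_)
  · rw [lintegral_const]
    refine ENNReal.mul_ne_top (ENNReal.rpow_ne_top_of_nonneg hq ENNReal.ofReal_ne_top) (by simp)
  · gcongr
    rw [← ofReal_norm]
    exact ENNReal.ofReal_le_ofReal (hC t (by rw [uIcc_of_le hε]; exact Ioc_subset_Icc_self ht))

theorem tsum_ne_top_of_summable_toReal {ι : Type*} {L : ι → ℝ≥0∞} (hL : ∀ i, L i ≠ ⊤)
    (h : Summable fun i => (L i).toReal) : ∑' i, L i ≠ ⊤ := by
  rw [tsum_congr fun i => (ENNReal.ofReal_toReal (hL i)).symm,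
    ← ENNReal.ofReal_tsum_of_nonneg (fun _ => ENNReal.toReal_nonneg) h]
  exact ENNReal.ofReal_ne_top

/-- Only the integral over each edge has to be finite: if the sum diverges, both sides take the
default value `0`. -/
theorem lpNormPow_eq (hε : 0 ≤ ε) {u : grid d ε → ℝ} (hu : MemH1 u) {q : ℝ} (hq : 0 ≤ q) :
    ε ^ (d - 1) * lpNormPow q u =
      (∫⁻ x, ‖onEdge u x.1 x.2‖ₑ ^ q ∂gridMeasure d ε).toReal := by
  rw [lintegral_gridMeasure ((measurable_enorm_onEdge hu.continuous).pow_const q),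
    ENNReal.toReal_mul, ENNReal.toReal_ofReal (by positivity),
    ENNReal.tsum_toReal_eq fun e => lintegral_enorm_onEdge_ne_top hε hu e hq, lpNormPow]
  congr 1
  exact tsum_congr fun e => intervalIntegral_abs_rpow_eq hε (measurable_onEdge hu.continuous e) hq

theorem derivNormSq_eq (hε : 0 ≤ ε) {u : grid d ε → ℝ} (hu : MemH1 u) :
    ε ^ (d - 1) * derivNormSq u =
      (∫⁻ x, ‖deriv (onEdge u x.1) x.2‖ₑ ^ (2 : ℝ) ∂gridMeasure d ε).toReal := by
  rw [lintegral_gridMeasure ((measurable_enorm_deriv_onEdge u).pow_const _),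
    ENNReal.toReal_mul, ENNReal.toReal_ofReal (by positivity),
    ENNReal.tsum_toReal_eq fun e => lintegral_enorm_deriv_ne_top hu e, derivNormSq]
  congr 1
  exact tsum_congr fun e => intervalIntegral_abs_rpow_eq hε (measurable_deriv _) (by norm_num)

theorem tsum_lintegral_sq_ne_top (hε : 0 ≤ ε) {u : grid d ε → ℝ} (hu : MemH1 u) :
    ∑' e : Edge d, ∫⁻ t in Ioc 0 ε, ‖onEdge u e t‖ₑ ^ (2 : ℝ) ≠ ⊤ := by
  refine tsum_ne_top_of_summable_toReal
    (fun e => lintegral_enorm_onEdge_ne_top hε hu e (by norm_num)) ?_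
  refine hu.summable_sq.congr fun e => ?_
  exact intervalIntegral_abs_rpow_eq hε (measurable_onEdge hu.continuous e) (by norm_num)

theorem tsum_lintegral_deriv_sq_ne_top (hε : 0 ≤ ε) {u : grid d ε → ℝ} (hu : MemH1 u) :
    ∑' e : Edge d, ∫⁻ t in Ioc 0 ε, ‖deriv (onEdge u e) t‖ₑ ^ (2 : ℝ) ≠ ⊤ := by
  refine tsum_ne_top_of_summable_toReal (fun e => lintegral_enorm_deriv_ne_top hu e) ?_
  refine hu.summable_deriv_sq.congr fun e => ?_
  exact intervalIntegral_abs_rpow_eq hε (measurable_deriv _) (by norm_num)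

theorem lintegral_sq_ne_top (hε : 0 ≤ ε) {u : grid d ε → ℝ} (hu : MemH1 u) :
    ∫⁻ x, ‖onEdge u x.1 x.2‖ₑ ^ (2 : ℝ) ∂gridMeasure d ε ≠ ⊤ := by
  rw [lintegral_gridMeasure ((measurable_enorm_onEdge hu.continuous).pow_const _)]
  exact ENNReal.mul_ne_top ENNReal.ofReal_ne_top (tsum_lintegral_sq_ne_top hε hu)

theorem lintegral_deriv_sq_ne_top (hε : 0 ≤ ε) {u : grid d ε → ℝ} (hu : MemH1 u) :
    ∫⁻ x, ‖deriv (onEdge u x.1) x.2‖ₑ ^ (2 : ℝ) ∂gridMeasure d ε ≠ ⊤ := by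
  rw [lintegral_gridMeasure ((measurable_enorm_deriv_onEdge u).pow_const _)]
  exact ENNReal.mul_ne_top ENNReal.ofReal_ne_top (tsum_lintegral_deriv_sq_ne_top hε hu)

/-! ### Pointwise bounds -/

/-- One-dimensional Sobolev embedding on an edge. -/
theorem enorm_sq_le_lintegral {f : ℝ → ℝ} (hε : 0 < ε)
    (hf : AbsolutelyContinuousOnInterval f 0 ε) (hfm : Measurable f) {x : ℝ} (hx : x ∈ Icc 0 ε) :
    ‖f x‖ₑ ^ (2 : ℝ) ≤ ((1 + 2 * ENNReal.ofReal ε) / ENNReal.ofReal ε) *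
      ((∫⁻ t in Ioc 0 ε, ‖f t‖ₑ ^ (2 : ℝ)) + ∫⁻ t in Ioc 0 ε, ‖deriv f t‖ₑ ^ (2 : ℝ)) := by
  set I := ∫⁻ t in Ioc 0 ε, ‖f t‖ₑ ^ (2 : ℝ)
  set J := ∫⁻ t in Ioc 0 ε, ‖deriv f t‖ₑ ^ (2 : ℝ)
  have hE : ENNReal.ofReal ε ≠ 0 := by simpa using hε
  have hprod : ∫⁻ t in Ioc 0 ε, ENNReal.ofReal 2 * (‖f t‖ₑ ^ ((2 : ℝ) - 1) * ‖deriv f t‖ₑ) ≤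
      2 * (I + J) := by
    rw [← lintegral_add_left (hfm.enorm.pow_const _), ← lintegral_const_mul' _ _ (by norm_num)]
    refine lintegral_mono fun t => ?_
    simp only [ENNReal.ofReal_ofNat]
    gcongr
    norm_num only
    simp only [ENNReal.rpow_one, ENNReal.rpow_two, sq]
    rcases le_total ‖f t‖ₑ ‖deriv f t‖ₑ with h | h
    · exact le_add_left (by gcongr)
    · exact le_add_right (by gcongr)
  -- The variation bound with exponent `2`, averaged over the base point `y` of the edge.
  have h1 : ENNReal.ofReal ε * ‖f x‖ₑ ^ (2 : ℝ) ≤ I + ENNReal.ofReal ε * (2 * (I + J)) := by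
    have hc : ∀ c : ℝ≥0∞, ∫⁻ _ in Ioc 0 ε, c = ENNReal.ofReal ε * c := fun c => by
      simp [mul_comm]
    rw [← hc, ← hc, ← lintegral_add_left (hfm.enorm.pow_const _)]
    refine setLIntegral_mono' measurableSet_Ioc fun y hy => ?_
    refine (enorm_rpow_le_add_lintegral one_lt_two hε.le hf hx (Ioc_subset_Icc_self hy)).trans ?_
    gcongr
  rw [← ENNReal.mul_div_right_comm, ENNReal.le_div_iff_mul_le (Or.inl hE)
    (Or.inl ENNReal.ofReal_ne_top), mul_comm]
  calc _ ≤ (I + J) + ENNReal.ofReal ε * (2 * (I + J)) :=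
        h1.trans (by gcongr; exact le_self_add)
    _ = _ := by ring

/-- The edgewise embedding bounds `u` uniformly, so `|u|^q` is dominated by `|u|^2`. The bound
degenerates as `ε → 0`; it serves only to make the absorption step legitimate. -/
theorem lintegral_rpow_ne_top (hε : 0 < ε) {u : grid d ε → ℝ} (hu : MemH1 u) {q : ℝ}
    (hq : 2 ≤ q) : ∫⁻ x, ‖onEdge u x.1 x.2‖ₑ ^ q ∂gridMeasure d ε ≠ ⊤ := by
  set K := (1 + 2 * ENNReal.ofReal ε) / ENNReal.ofReal ε
  have hK : K ≠ ⊤ := ENNReal.div_ne_top (by simp [ENNReal.mul_eq_top]) (by simpa using hε)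
  set S := K * ((∑' e : Edge d, ∫⁻ t in Ioc 0 ε, ‖onEdge u e t‖ₑ ^ (2 : ℝ)) +
    ∑' e : Edge d, ∫⁻ t in Ioc 0 ε, ‖deriv (onEdge u e) t‖ₑ ^ (2 : ℝ))
  have hS : S ≠ ⊤ := ENNReal.mul_ne_top hK (ENNReal.add_ne_top.2
    ⟨tsum_lintegral_sq_ne_top hε.le hu, tsum_lintegral_deriv_sq_ne_top hε.le hu⟩)
  have hb : ∀ e, ∀ t ∈ Ioc 0 ε, ‖onEdge u e t‖ₑ ^ (2 : ℝ) ≤ S := fun e t ht => by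
    refine (enorm_sq_le_lintegral hε (hu.absolutelyContinuous e) (measurable_onEdge hu.continuous e)
      (Ioc_subset_Icc_self ht)).trans ?_
    show K * _ ≤ K * _
    gcongr <;> exact ENNReal.le_tsum e
  have h2 : 0 ≤ (q - 2) / 2 := by linarith
  have hle : ∫⁻ x, ‖onEdge u x.1 x.2‖ₑ ^ q ∂gridMeasure d ε ≤
      S ^ ((q - 2) / 2) * ∫⁻ x, ‖onEdge u x.1 x.2‖ₑ ^ (2 : ℝ) ∂gridMeasure d ε := by
    rw [lintegral_gridMeasure ((measurable_enorm_onEdge hu.continuous).pow_const _),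
      lintegral_gridMeasure ((measurable_enorm_onEdge hu.continuous).pow_const _),
      mul_left_comm, ← ENNReal.tsum_mul_left (a := S ^ _)]
    refine mul_le_mul' le_rfl (ENNReal.tsum_le_tsum fun e => ?_)
    rw [← lintegral_const_mul' _ _ (ENNReal.rpow_ne_top_of_nonneg h2 hS)]
    refine setLIntegral_mono' measurableSet_Ioc fun t ht => ?_
    calc ‖onEdge u e t‖ₑ ^ q
        = (‖onEdge u e t‖ₑ ^ (2 : ℝ)) ^ ((q - 2) / 2) * ‖onEdge u e t‖ₑ ^ (2 : ℝ) := by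
          rw [← ENNReal.rpow_mul, ← ENNReal.rpow_add_of_nonneg _ _ (by linarith) (by norm_num)]
          congr 1; ring
      _ ≤ _ := by gcongr; exact hb e t ht
  exact ne_top_of_le_ne_top (ENNReal.mul_ne_top (ENNReal.rpow_ne_top_of_nonneg h2 hS)
    (lintegral_sq_ne_top hε.le hu)) hle

/-- By the edgewise embedding, the squares of the vertex values along a ray are summable, since
distinct vertices use distinct edges. -/
theorem tendsto_onEdge_line (hε : 0 < ε) {u : grid d ε → ℝ} (hu : MemH1 u) {s : ℝ} (hs : 0 < s)
    (k : Fin d → ℤ) (i j : Fin d) :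
    Tendsto (fun N : ℕ => ‖onEdge u (update k j (k j + N), i) 0‖ₑ ^ s) atTop (𝓝 0) := by
  set K := (1 + 2 * ENNReal.ofReal ε) / ENNReal.ofReal ε
  have hK : K ≠ ⊤ := ENNReal.div_ne_top (by simp [ENNReal.mul_eq_top]) (by simpa using hε)
  have hsum : ∑' N : ℕ, ‖onEdge u (update k j (k j + N), i) 0‖ₑ ^ (2 : ℝ) ≠ ⊤ := by
    have hinj : Injective fun N : ℕ => ((update k j (k j + N), i) : Edge d) := by
      intro a b hab
      have := congrFun (Prod.ext_iff.1 hab).1 j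
      simpa using this
    refine ne_top_of_le_ne_top ?_ (ENNReal.tsum_le_tsum fun N => enorm_sq_le_lintegral hε
      (hu.absolutelyContinuous _) (measurable_onEdge hu.continuous _) (left_mem_Icc.2 hε.le))
    rw [ENNReal.tsum_mul_left, ENNReal.tsum_add]
    refine ENNReal.mul_ne_top hK (ENNReal.add_ne_top.2 ⟨?_, ?_⟩)
    · exact ne_top_of_le_ne_top (tsum_lintegral_sq_ne_top hε.le hu)
        (ENNReal.tsum_comp_le_tsum_of_injective hinj _)
    · exact ne_top_of_le_ne_top (tsum_lintegral_deriv_sq_ne_top hε.le hu)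
        (ENNReal.tsum_comp_le_tsum_of_injective hinj _)
  have h := (ENNReal.continuous_rpow_const (y := s / 2)).continuousAt.tendsto.comp
    (ENNReal.tendsto_atTop_zero_of_tsum_ne_top hsum)
  rw [ENNReal.zero_rpow_of_pos (by positivity)] at h
  refine h.congr fun N => ?_
  simp only [comp_apply]
  rw [← ENNReal.rpow_mul]
  congr 1; ring

/-! ### The Sobolev inequality on the grid -/

/-- The Sobolev inequality on the grid, with a constant independent of the edgelength. -/
theorem grid_sobolev (hd : 2 ≤ d) (hε : 0 < ε) {u : grid d ε → ℝ} (hu : MemH1 u) {s : ℝ}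
    (hs : 1 < s) :
    ∫⁻ x, ‖onEdge u x.1 x.2‖ₑ ^ (s * ((d : ℝ) / (d - 1))) ∂gridMeasure d ε ≤
      (d * ENNReal.ofReal (2 * s) ^ ((d : ℝ) / (d - 1))) *
        (∫⁻ x, ‖onEdge u x.1 x.2‖ₑ ^ (s - 1) * ‖deriv (onEdge u x.1) x.2‖ₑ ∂gridMeasure d ε) ^
          ((d : ℝ) / (d - 1)) := by
  have hd1 : (0 : ℝ) < d - 1 := by
    have : (1 : ℝ) < d := by exact_mod_cast hd
    linarith
  have hs0 : 0 < s := by linarith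
  set m : ℝ := (d : ℝ) / (d - 1) with hm
  have hm0 : 0 ≤ m := by positivity
  set F : Edge d → ℝ≥0∞ := fun e => ∫⁻ t in Ioc 0 ε,
    ENNReal.ofReal s * (‖onEdge u e t‖ₑ ^ (s - 1) * ‖deriv (onEdge u e) t‖ₑ) with hF
  -- All `d` edges issuing from `k` are put together, so that a lattice line through `k` in any
  -- direction `j` also accounts for the edge containing the point.
  set f : (Fin d → ℤ) → ℝ≥0∞ := fun k => ∑ i, F (k, i) with hf
  have hFf : ∀ k i, F (k, i) ≤ f k := fun k i =>
    Finset.single_le_sum (f := fun i => F (k, i)) (fun _ _ => zero_le) (Finset.mem_univ i)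
  have hline : ∀ k i j, ‖onEdge u (k, i) 0‖ₑ ^ s ≤ ∑' n : ℤ, f (update k j n) := by
    intro k i j
    refine le_tsum_line (w := fun k => ‖onEdge u (k, i) 0‖ₑ ^ s) (fun k => ?_) k
      (tendsto_onEdge_line hε hu hs0 k i j)
    rw [← onEdge_end hε.le u k j i, onEdge_zero hε.le u k i j]
    refine (enorm_rpow_le_add_lintegral hs hε.le (hu.absolutelyContinuous (k, j))
      (left_mem_Icc.2 hε.le) (right_mem_Icc.2 hε.le)).trans ?_
    gcongr
    exact hFf k j
  have hpt : ∀ k i j, ∀ t ∈ Ioc 0 ε,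
      ‖onEdge u (k, i) t‖ₑ ^ s ≤ 2 * ∑' n : ℤ, f (update k j n) := by
    intro k i j t ht
    refine (enorm_rpow_le_add_lintegral hs hε.le (hu.absolutelyContinuous (k, i))
      (Ioc_subset_Icc_self ht) (left_mem_Icc.2 hε.le)).trans ?_
    rw [two_mul]
    refine add_le_add (hline k i j) ((hFf k i).trans ?_)
    simpa using ENNReal.le_tsum (f := fun n : ℤ => f (update k j n)) (k j)
  set G : (Fin d → ℤ) → ℝ≥0∞ := fun k =>
    ∏ j, (∑' n : ℤ, f (update k j n)) ^ (1 / ((d : ℝ) - 1)) with hG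
  -- Product of the `d` directional bounds, each to the power `1/(d-1)`; the exponents add up to
  -- `m`.
  have hptG : ∀ k i, ∀ t ∈ Ioc 0 ε, ‖onEdge u (k, i) t‖ₑ ^ (s * m) ≤ 2 ^ m * G k := by
    intro k i t ht
    have hpow : ∀ x : ℝ≥0∞, ∏ _j : Fin d, x ^ (1 / ((d : ℝ) - 1)) = x ^ m := fun x => by
      rw [Finset.prod_const, Finset.card_univ, Fintype.card_fin, ← ENNReal.rpow_natCast,
        ← ENNReal.rpow_mul, hm]
      congr 1; field_simp
    rw [ENNReal.rpow_mul, ← hpow, ← hpow, hG, ← Finset.prod_mul_distrib]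
    refine Finset.prod_le_prod' fun j _ => ?_
    rw [← ENNReal.mul_rpow_of_nonneg _ _ (by positivity)]
    exact ENNReal.rpow_le_rpow (hpt k i j t ht) (by positivity)
  have hsumF : ∑' k, f k = ENNReal.ofReal s * ∑' e : Edge d, ∫⁻ t in Ioc 0 ε,
      ‖onEdge u e t‖ₑ ^ (s - 1) * ‖deriv (onEdge u e) t‖ₑ := by
    rw [← ENNReal.tsum_mul_left, ENNReal.tsum_prod']
    refine tsum_congr fun k => ?_
    rw [tsum_fintype]
    refine Finset.sum_congr rfl fun i _ => ?_
    exact lintegral_const_mul' _ _ ENNReal.ofReal_ne_top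
  set Z := ∑' e : Edge d, ∫⁻ t in Ioc 0 ε, ‖onEdge u e t‖ₑ ^ (s - 1) * ‖deriv (onEdge u e) t‖ₑ
  have hmain : ∑' e : Edge d, ∫⁻ t in Ioc 0 ε, ‖onEdge u e t‖ₑ ^ (s * m) ≤
      d * ENNReal.ofReal ε * (2 ^ m * (ENNReal.ofReal s * Z) ^ m) := by
    rw [ENNReal.tsum_prod', ← hsumF]
    calc ∑' k, ∑' i, ∫⁻ t in Ioc 0 ε, ‖onEdge u (k, i) t‖ₑ ^ (s * m)
        ≤ ∑' k, d * ENNReal.ofReal ε * (2 ^ m * G k) := by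
          refine ENNReal.tsum_le_tsum fun k => ?_
          rw [tsum_fintype]
          refine (Finset.sum_le_card_nsmul _ _ (ENNReal.ofReal ε * (2 ^ m * G k))
            fun i _ => ?_).trans_eq ?_
          · refine (setLIntegral_mono' measurableSet_Ioc (hptG k i)).trans_eq ?_
            simp [mul_comm]
          · simp [mul_assoc]
      _ = d * ENNReal.ofReal ε * (2 ^ m * ∑' k, G k) := by
          rw [ENNReal.tsum_mul_left, ENNReal.tsum_mul_left]
      _ ≤ _ := by gcongr; exact tsum_prod_tsum_rpow_le hd f
  rw [lintegral_gridMeasure ((measurable_enorm_onEdge hu.continuous).pow_const _),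
    lintegral_gridMeasure (f := fun x => ‖onEdge u x.1 x.2‖ₑ ^ (s - 1) * ‖deriv (onEdge u x.1) x.2‖ₑ)
      (((measurable_enorm_onEdge hu.continuous).pow_const _).mul
        (measurable_enorm_deriv_onEdge u))]
  -- Since `(d - 1) m = d`, the weight times one edge length is the weight to the power `m`, and `ε`
  -- cancels.
  have hscale : ENNReal.ofReal (ε ^ (d - 1)) * ENNReal.ofReal ε =
      ENNReal.ofReal (ε ^ (d - 1)) ^ m := by
    rw [ENNReal.ofReal_rpow_of_nonneg (by positivity) hm0, ← ENNReal.ofReal_mul (by positivity),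
      ← pow_succ, ← Real.rpow_natCast ε (d - 1), ← Real.rpow_mul hε.le, ← Real.rpow_natCast,
      Nat.cast_sub (by omega : 1 ≤ d), Nat.sub_add_cancel (by omega : 1 ≤ d), hm]
    congr 2
    push_cast
    field_simp
  calc _ ≤ ENNReal.ofReal (ε ^ (d - 1)) *
        (d * ENNReal.ofReal ε * (2 ^ m * (ENNReal.ofReal s * Z) ^ m)) := by gcongr
    _ = d * (2 ^ m * ENNReal.ofReal s ^ m) *
        ((ENNReal.ofReal (ε ^ (d - 1)) * ENNReal.ofReal ε) * Z ^ m) := by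
        rw [ENNReal.mul_rpow_of_nonneg _ _ hm0]; ring
    _ = _ := by
        rw [hscale, ← ENNReal.mul_rpow_of_nonneg _ _ hm0, ← ENNReal.mul_rpow_of_nonneg _ _ hm0,
          ENNReal.ofReal_mul (by norm_num : (0 : ℝ) ≤ 2), ENNReal.ofReal_ofNat]

/-! ### The Gagliardo-Nirenberg inequality on the grid -/

theorem mul_lt_of_lt_criticalExponent {d : ℕ} (hd : 2 ≤ d) {p : ℝ}
    (hp : (p : EReal) < criticalExponent d) : p * (d - 2) < 2 * d := by
  unfold criticalExponent at hp
  split_ifs at hp with h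
  · subst h; norm_num
  · have h3 : (0 : ℝ) < d - 2 := by
      have : (2 : ℝ) < d := by exact_mod_cast (by omega : 2 < d)
      linarith
    rw [EReal.coe_lt_coe_iff, lt_div_iff₀ h3] at hp
    exact hp

/-- The Gagliardo-Nirenberg inequality on the grid, with a constant independent of the
edgelength. -/
theorem gagliardo_nirenberg {d : ℕ} (hd : 2 ≤ d) {p : ℝ} (hp : 2 < p)
    (hp' : (p : EReal) < criticalExponent d) :
    ∃ K α β : ℝ, 0 < K ∧ 0 < α ∧ 0 < β ∧ 1 < α + β ∧ ∀ ε : ℝ, 0 < ε → ∀ u : grid d ε → ℝ,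
      MemH1 u → ε ^ (d - 1) * lpNormPow p u ≤
        K * (ε ^ (d - 1) * derivNormSq u) ^ α * (ε ^ (d - 1) * lpNormPow 2 u) ^ β := by
  have hd2 : (2 : ℝ) ≤ d := by exact_mod_cast hd
  have hd1 : (0 : ℝ) < d - 1 := by linarith
  have hpd := mul_lt_of_lt_criticalExponent hd hp'
  set m : ℝ := (d : ℝ) / (d - 1) with hm
  have hm1 : 1 < m := by rw [hm, lt_div_iff₀ hd1]; linarith
  have hm2 : m ≤ 2 := by rw [hm, div_le_iff₀ hd1]; linarith
  have hm0 : 0 < m := by linarith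
  have hmd : 2 / m - 1 = (d - 2) / d := by rw [hm]; field_simp; ring
  -- An auxiliary exponent, still subcritical: `q ≥ 2m` makes `s ≥ 2`, hence `θ ≤ 1`, and `q (d - 2)
  -- / d < 2` makes `2 (s - 1) < q`, hence `θ > 0`.
  set q : ℝ := max p (2 * m) with hq
  have hqp : p ≤ q := le_max_left _ _
  have hqm : 2 * m ≤ q := le_max_right _ _
  have hq2 : 2 < q := by linarith
  have hqd : q * (2 / m - 1) < 2 := by
    rw [hmd, ← mul_div_assoc, div_lt_iff₀ (by linarith)]
    rcases max_choice p (2 * m) with h | h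
    · rw [hq, h]; exact hpd
    · rw [hq, h, hm, mul_assoc, div_mul_eq_mul_div, mul_div_assoc]
      have : (d - 2) / (d - 1) < (1 : ℝ) := by rw [div_lt_one hd1]; linarith
      nlinarith
  set s : ℝ := q / m with hs
  have hsm : s * m = q := by rw [hs]; field_simp
  have hs2 : 2 ≤ s := by rw [hs, le_div_iff₀ hm0]; exact hqm
  have hsq : 2 * (s - 1) < q := by
    have : q * (2 / m - 1) = 2 * s - q := by rw [hs]; ring
    linarith
  set θ : ℝ := (q - 2 * (s - 1)) / (q - 2) with hθ
  have hθ0 : 0 < θ := div_pos (by linarith) (by linarith)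
  have hθ1 : θ ≤ 1 := by rw [hθ, div_le_one (by linarith)]; linarith
  have hs' : 2 * (s - 1) = 2 * θ + q * (1 - θ) := by
    have : θ * (q - 2) = q - 2 * (s - 1) := div_mul_cancel₀ _ (by linarith)
    linarith
  set η : ℝ := (q - p) / (q - 2) with hη
  have hη0 : 0 ≤ η := div_nonneg (by linarith) (by linarith)
  have hη1 : η < 1 := by rw [hη, div_lt_one (by linarith)]; linarith
  have hpη : p = 2 * η + q * (1 - η) := by
    have : η * (q - 2) = q - p := div_mul_cancel₀ _ (by linarith)
    linarith
  set δ : ℝ := 1 - (1 - θ) * (m / 2) with hδ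
  have hδ0 : 0 < δ := by nlinarith
  have h1η : 0 < 1 - η := by linarith
  set κ : ℝ := (1 - η) / δ with hκ
  have hκ0 : 0 < κ := by positivity
  have hκδ : κ * δ = 1 - η := div_mul_cancel₀ _ hδ0.ne'
  set C : ℝ≥0∞ := d * ENNReal.ofReal (2 * s) ^ m with hC
  have hCtop : C ≠ ⊤ := ENNReal.mul_ne_top (ENNReal.natCast_ne_top d)
    (ENNReal.rpow_ne_top_of_nonneg hm0.le ENNReal.ofReal_ne_top)
  have hC0 : C ≠ 0 := mul_ne_zero (by simp; omega) (by
    rw [Ne, ENNReal.rpow_eq_zero_iff]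
    simp only [ENNReal.ofReal_eq_zero, ENNReal.ofReal_ne_top, false_and, or_false, not_and]
    intro h; linarith)
  refine ⟨(C ^ κ).toReal, m / 2 * κ, η + θ * (m / 2) * κ, ?_, by positivity, by positivity, ?_, ?_⟩
  · exact ENNReal.toReal_pos (by simp [ENNReal.rpow_eq_zero_iff, hC0, hCtop])
      (ENNReal.rpow_ne_top_of_nonneg hκ0.le hCtop)
  -- The two exponents add up to exactly `1 + κ (m - 1)`.
  · have : κ * (m - 1) > 0 := mul_pos hκ0 (by linarith)
    have : 1 - η = κ - (1 - θ) * (m / 2) * κ := by rw [← hκδ, hδ]; ring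
    nlinarith
  · intro ε hε u hu
    have hS := grid_sobolev hd hε hu (s := s) (by linarith)
    rw [← hm, hsm] at hS
    have h := lintegral_rpow_le_of_sobolev (measurable_enorm_onEdge hu.continuous).aemeasurable
      (measurable_enorm_deriv_onEdge u).aemeasurable hm0.le (by linarith) hθ0.le hθ1 hs' hη0
      hη1.le hpη hδ hδ0 hS (lintegral_rpow_ne_top hε hu hq2.le)
    rw [lpNormPow_eq hε.le hu (by linarith), lpNormPow_eq hε.le hu (by norm_num),
      derivNormSq_eq hε.le hu, ENNReal.toReal_rpow, ENNReal.toReal_rpow, ← ENNReal.toReal_mul,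
      ← ENNReal.toReal_mul]
    refine ENNReal.toReal_mono ?_ h
    refine ENNReal.mul_ne_top (ENNReal.mul_ne_top ?_ ?_) ?_
    · exact ENNReal.rpow_ne_top_of_nonneg hκ0.le hCtop
    · exact ENNReal.rpow_ne_top_of_nonneg (by positivity) (lintegral_deriv_sq_ne_top hε.le hu)
    · exact ENNReal.rpow_ne_top_of_nonneg (by positivity) (lintegral_sq_ne_top hε.le hu)

/-! ### Scaling -/

theorem onEdge_const_mul (c : ℝ) (u : grid d ε → ℝ) (e : Edge d) :
    onEdge (fun x => c * u x) e = fun t => c * onEdge u e t := by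
  funext t
  unfold onEdge
  split_ifs <;> simp

theorem deriv_onEdge_const_mul (c : ℝ) (u : grid d ε → ℝ) (e : Edge d) (t : ℝ) :
    deriv (onEdge (fun x => c * u x) e) t = c * deriv (onEdge u e) t := by
  rw [onEdge_const_mul]
  exact deriv_const_mul_field c

theorem integral_onEdge_const_mul {c : ℝ} (hc : 0 ≤ c) (u : grid d ε → ℝ) (q : ℝ) (e : Edge d) :
    ∫ t in (0 : ℝ)..ε, |onEdge (fun x => c * u x) e t| ^ q =
      c ^ q * ∫ t in (0 : ℝ)..ε, |onEdge u e t| ^ q := by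
  rw [← intervalIntegral.integral_const_mul, onEdge_const_mul]
  simp only [abs_mul, abs_of_nonneg hc, Real.mul_rpow hc (abs_nonneg _)]

theorem integral_deriv_onEdge_const_mul {c : ℝ} (hc : 0 ≤ c) (u : grid d ε → ℝ) (q : ℝ)
    (e : Edge d) :
    ∫ t in (0 : ℝ)..ε, |deriv (onEdge (fun x => c * u x) e) t| ^ q =
      c ^ q * ∫ t in (0 : ℝ)..ε, |deriv (onEdge u e) t| ^ q := by
  rw [← intervalIntegral.integral_const_mul]
  simp only [deriv_onEdge_const_mul, abs_mul, abs_of_nonneg hc, Real.mul_rpow hc (abs_nonneg _)]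

theorem lpNormPow_const_mul {c : ℝ} (hc : 0 ≤ c) (u : grid d ε → ℝ) (q : ℝ) :
    lpNormPow q (fun x => c * u x) = c ^ q * lpNormPow q u := by
  unfold lpNormPow
  simp only [integral_onEdge_const_mul hc, tsum_mul_left]

theorem derivNormSq_const_mul {c : ℝ} (hc : 0 ≤ c) (u : grid d ε → ℝ) :
    derivNormSq (fun x => c * u x) = c ^ (2 : ℝ) * derivNormSq u := by
  unfold derivNormSq
  simp only [integral_deriv_onEdge_const_mul hc, tsum_mul_left]

theorem MemH1.const_mul {c : ℝ} (hc : 0 ≤ c) {u : grid d ε → ℝ} (hu : MemH1 u) :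
    MemH1 fun x => c * u x where
  continuous := continuous_const.mul hu.continuous
  absolutelyContinuous e := by
    rw [onEdge_const_mul]; exact (hu.absolutelyContinuous e).const_mul c
  memLp_deriv e := by
    have : deriv (onEdge (fun x => c * u x) e) = fun t => c * deriv (onEdge u e) t :=
      funext (deriv_onEdge_const_mul c u e)
    rw [this]
    exact (hu.memLp_deriv e).const_mul c
  summable_sq := by
    simp only [integral_onEdge_const_mul hc]; exact hu.summable_sq.mul_left _
  summable_deriv_sq := by
    simp only [integral_deriv_onEdge_const_mul hc]; exact hu.summable_deriv_sq.mul_left _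

/-- The point of the Nehari manifold on the ray through `u`. -/
theorem const_mul_mem_nehari {p ω : ℝ} (hp : 2 < p) {u : grid d ε → ℝ} (hu : MemH1 u)
    (h0 : u ≠ 0) (hD : 0 < (d : ℝ) * derivNormSq u + ω * lpNormPow 2 u)
    (hP : 0 < lpNormPow p u) :
    (fun x => (((d : ℝ) * derivNormSq u + ω * lpNormPow 2 u) / lpNormPow p u) ^ (1 / (p - 2)) *
      u x) ∈ nehari d ε p ω := by
  set D := (d : ℝ) * derivNormSq u + ω * lpNormPow 2 u with hDdef
  set c := (D / lpNormPow p u) ^ (1 / (p - 2)) with hc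
  have hc0 : 0 < c := by positivity
  have hp2 : p - 2 ≠ 0 := by linarith
  refine ⟨hu.const_mul hc0.le, fun h => h0 (funext fun x => ?_), ?_⟩
  · simpa [hc0.ne'] using congrFun h x
  · rw [derivNormSq_const_mul hc0.le, lpNormPow_const_mul hc0.le, lpNormPow_const_mul hc0.le]
    have : c ^ p = c ^ (2 : ℝ) * (D / lpNormPow p u) := by
      have h1 : c ^ (p - 2) = D / lpNormPow p u := by
        rw [hc, ← Real.rpow_mul (by positivity), one_div_mul_cancel hp2, Real.rpow_one]
      rw [← h1, ← Real.rpow_add hc0]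
      congr 1; ring
    rw [this, mul_assoc, div_mul_cancel₀ _ hP.ne', hDdef]
    ring

/-- The quadratic part of the action is `1/(2d)` times the left side of the Nehari identity. -/
theorem action_eq_of_mem_nehari {p ω : ℝ} (hd : 2 ≤ d) (hp : 2 < p) {u : grid d ε → ℝ}
    (hu : u ∈ nehari d ε p ω) : action p ω u = (1 / 2 - 1 / p) / d * lpNormPow p u := by
  have hd0 : (d : ℝ) ≠ 0 := by exact_mod_cast (by omega : d ≠ 0)
  have : p ≠ 0 := by linarith
  unfold action
  rw [← hu.2.2]
  field_simp

/-- A ground state has the least `L^p` norm on the Nehari manifold. -/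
theorem IsGroundState.lpNormPow_le {p ω : ℝ} (hd : 2 ≤ d) (hε : 0 < ε) (hp : 2 < p)
    {u v : grid d ε → ℝ} (hu : IsGroundState p ω u) (hv : v ∈ nehari d ε p ω) :
    lpNormPow p u ≤ lpNormPow p v := by
  have h : action p ω u ≤ action p ω v := by
    rw [hu.2]
    exact csInf_le (bddBelow_action hd hε hp) ⟨v, hv, rfl⟩
  rw [action_eq_of_mem_nehari hd hp hu.1, action_eq_of_mem_nehari hd hp hv] at h
  have hd0 : (0 : ℝ) < d := by exact_mod_cast (by omega : 0 < d)
  have : 1 / p < 1 / 2 := one_div_lt_one_div_of_lt (by norm_num) hp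
  exact le_of_mul_le_mul_left h (div_pos (by linarith) hd0)

/-! ### A test function -/

/-- The restriction to the grid of the tent `x ↦ (1 - ‖x‖)⁺`. -/
def tent (d : ℕ) (ε : ℝ) (x : grid d ε) : ℝ := max 0 (1 - ‖x.1‖)

theorem edgePoint_eq (ε : ℝ) (e : Edge d) (t : ℝ) :
    edgePoint ε e t = edgePoint ε e 0 + t • EuclideanSpace.single e.2 (1 : ℝ) := by
  ext j
  by_cases h : j = e.2 <;> simp [edgePoint, h]

theorem norm_edgePoint_sub (ε : ℝ) (e : Edge d) (t t' : ℝ) :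
    ‖edgePoint ε e t - edgePoint ε e t'‖ = |t - t'| := by
  rw [edgePoint_eq ε e t, edgePoint_eq ε e t', add_sub_add_left_eq_sub, ← sub_smul, norm_smul]
  simp

/-- Concerns the formula on the whole line, because `onEdge` may jump to `0` at the ends of the
edge. -/
theorem lipschitzWith_tent_edgePoint (ε : ℝ) (e : Edge d) :
    LipschitzWith 1 fun t => max 0 (1 - ‖edgePoint ε e t‖) := by
  refine LipschitzWith.of_dist_le_mul fun t t' => ?_
  rw [NNReal.coe_one, one_mul, Real.dist_eq, Real.dist_eq, ← norm_edgePoint_sub ε e t t']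
  rw [max_comm 0, max_comm 0]
  refine (abs_max_sub_max_le_abs _ _ _).trans ?_
  rw [sub_sub_sub_cancel_left, abs_sub_comm]
  exact abs_norm_sub_norm_le _ _

theorem onEdge_tent (e : Edge d) {t : ℝ} (ht : t ∈ Icc 0 ε) :
    onEdge (tent d ε) e t = max 0 (1 - ‖edgePoint ε e t‖) := onEdge_of_mem _ _ ht

theorem deriv_onEdge_tent (e : Edge d) {t : ℝ} (ht : t ∈ Ioo 0 ε) :
    deriv (onEdge (tent d ε) e) t = deriv (fun t => max 0 (1 - ‖edgePoint ε e t‖)) t := by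
  refine EventuallyEq.deriv_eq ?_
  filter_upwards [isOpen_Ioo.mem_nhds ht] with x hx
  exact onEdge_tent e (Ioo_subset_Icc_self hx)

theorem abs_deriv_onEdge_tent_le (e : Edge d) {t : ℝ} (ht : t ∈ Ioo 0 ε) :
    |deriv (onEdge (tent d ε) e) t| ≤ 1 := by
  rw [deriv_onEdge_tent e ht]
  simpa using norm_deriv_le_of_lipschitz (lipschitzWith_tent_edgePoint ε e) (x₀ := t)

theorem abs_onEdge_tent_le (e : Edge d) (t : ℝ) : |onEdge (tent d ε) e t| ≤ 1 := by
  by_cases ht : t ∈ Icc 0 ε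
  · rw [onEdge_tent e ht, abs_of_nonneg (le_max_left _ _)]
    exact max_le zero_le_one (by linarith [norm_nonneg (edgePoint ε e t)])
  · simp [onEdge, ht]

theorem continuous_tent : Continuous (tent d ε) := by
  unfold tent; fun_prop

theorem absolutelyContinuous_tent (hε : 0 ≤ ε) (e : Edge d) :
    AbsolutelyContinuousOnInterval (onEdge (tent d ε) e) 0 ε := by
  refine LipschitzOnWith.absolutelyContinuousOnInterval (K := 1) fun x hx y hy => ?_
  rw [uIcc_of_le hε] at hx hy
  rw [onEdge_tent e hx, onEdge_tent e hy]
  exact lipschitzWith_tent_edgePoint ε e x y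

/-- The edges that may meet the support of `tent`. -/
def nearEdges (d : ℕ) (ε : ℝ) : Finset (Edge d) :=
  Finset.Icc (fun _ => -(⌈2 / ε⌉₊ : ℤ)) (fun _ => (⌈2 / ε⌉₊ : ℤ)) ×ˢ Finset.univ

theorem card_nearEdges_le (hε : 0 < ε) (hε1 : ε ≤ 1 / 4) :
    ((nearEdges d ε).card : ℝ) ≤ d * (5 / ε) ^ d := by
  have h1 : (nearEdges d ε).card = (2 * ⌈2 / ε⌉₊ + 1) ^ d * d := by
    rw [nearEdges, Finset.card_product, Pi.card_Icc]
    simp only [Int.card_Icc, Finset.prod_const, Finset.card_univ, Fintype.card_fin]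
    congr 2
    omega
  rw [h1, mul_comm]
  push_cast
  gcongr
  have h2 : (⌈2 / ε⌉₊ : ℝ) < 2 / ε + 1 := Nat.ceil_lt_add_one (by positivity)
  have h3 : 4 ≤ 1 / ε := by rw [le_div_iff₀ hε]; linarith
  have h4 : 2 / ε = 2 * (1 / ε) := by ring
  have h5 : 5 / ε = 5 * (1 / ε) := by ring
  rw [h5]
  rw [h4] at h2 ⊢
  linarith

/-- The initial vertex of such an edge has norm at least `2`, and the edge is shorter than `1`. -/
theorem tent_eq_zero_of_notMem (hε : 0 < ε) (hε1 : ε ≤ 1 / 4) {e : Edge d}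
    (he : e ∉ nearEdges d ε) {t : ℝ} (ht : t ∈ Icc 0 ε) :
    max 0 (1 - ‖edgePoint ε e t‖) = 0 := by
  have : ∃ j, (⌈2 / ε⌉₊ : ℤ) < |e.1 j| := by
    by_contra! h
    refine he (Finset.mem_product.2 ⟨Finset.mem_Icc.2 ⟨fun j => ?_, fun j => ?_⟩,
      Finset.mem_univ _⟩)
    · exact (abs_le.1 (h j)).1
    · exact (abs_le.1 (h j)).2
  obtain ⟨j, hj⟩ := this
  have h1 : (2 / ε : ℝ) ≤ |(e.1 j : ℝ)| := by
    calc 2 / ε ≤ ⌈2 / ε⌉₊ := Nat.le_ceil _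
      _ ≤ _ := by exact_mod_cast hj.le
  rw [div_le_iff₀ hε] at h1
  have h2 : ‖edgePoint ε e 0‖ ≤ ‖edgePoint ε e t‖ + t := by
    have := norm_edgePoint_sub ε e 0 t
    have h3 := norm_sub_norm_le (edgePoint ε e 0) (edgePoint ε e t)
    rw [this, zero_sub, abs_neg, abs_of_nonneg ht.1] at h3
    linarith
  have h3 : |(e.1 j : ℝ)| * ε ≤ ‖edgePoint ε e 0‖ := by
    refine le_trans (le_of_eq ?_) (PiLp.norm_apply_le (edgePoint ε e 0) j)
    simp [edgePoint, abs_of_pos hε, mul_comm]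
  refine max_eq_left ?_
  linarith [ht.2]

theorem onEdge_tent_eq_zero (hε : 0 < ε) (hε1 : ε ≤ 1 / 4) {e : Edge d}
    (he : e ∉ nearEdges d ε) (t : ℝ) : onEdge (tent d ε) e t = 0 := by
  by_cases ht : t ∈ Icc 0 ε
  · rw [onEdge_tent e ht, tent_eq_zero_of_notMem hε hε1 he ht]
  · simp [onEdge, ht]

theorem integral_tent_eq_zero (hε : 0 < ε) (hε1 : ε ≤ 1 / 4) {q : ℝ} (hq : 0 < q) {e : Edge d}
    (he : e ∉ nearEdges d ε) : ∫ t in (0 : ℝ)..ε, |onEdge (tent d ε) e t| ^ q = 0 := by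
  simp [onEdge_tent_eq_zero hε hε1 he, Real.zero_rpow hq.ne']

theorem integral_deriv_tent_eq_zero (hε : 0 < ε) (hε1 : ε ≤ 1 / 4) {e : Edge d}
    (he : e ∉ nearEdges d ε) : ∫ t in (0 : ℝ)..ε, |deriv (onEdge (tent d ε) e) t| ^ (2 : ℝ) = 0 := by
  have : onEdge (tent d ε) e = fun _ => 0 := funext (onEdge_tent_eq_zero hε hε1 he)
  simp [this]

theorem summable_tent (hε : 0 < ε) (hε1 : ε ≤ 1 / 4) {q : ℝ} (hq : 0 < q) :
    Summable fun e : Edge d => ∫ t in (0 : ℝ)..ε, |onEdge (tent d ε) e t| ^ q :=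
  summable_of_ne_finset_zero (s := nearEdges d ε) fun _ he => integral_tent_eq_zero hε hε1 hq he

theorem memH1_tent (hε : 0 < ε) (hε1 : ε ≤ 1 / 4) : MemH1 (tent d ε) where
  continuous := continuous_tent
  absolutelyContinuous := absolutelyContinuous_tent hε.le
  memLp_deriv e := by
    refine MemLp.of_bound (measurable_deriv _).aestronglyMeasurable 1 ?_
    filter_upwards [ae_restrict_mem measurableSet_Ioo] with t ht
    exact abs_deriv_onEdge_tent_le e ht
  summable_sq := summable_tent hε hε1 (by norm_num)
  summable_deriv_sq := summable_of_ne_finset_zero (s := nearEdges d ε)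
    fun _ he => integral_deriv_tent_eq_zero hε hε1 he

theorem integral_rpow_le_of_abs_le_one (hε : 0 ≤ ε) {g : ℝ → ℝ} (hg : ∀ t ∈ Ioo 0 ε, |g t| ≤ 1)
    {q : ℝ} (hq : 0 ≤ q) : ∫ t in (0 : ℝ)..ε, |g t| ^ q ≤ ε := by
  have h : ‖∫ t in (0 : ℝ)..ε, |g t| ^ q‖ ≤ 1 * |ε - 0| := by
    refine intervalIntegral.norm_integral_le_of_norm_le_const_ae ?_
    -- The bound is assumed only on the open edge, as needed for derivatives; the endpoint is a null
    -- set.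
    have : ∀ᵐ t : ℝ, t ≠ ε := by simp [ae_iff]
    filter_upwards [this] with t hne ht
    rw [uIoc_of_le hε] at ht
    rw [Real.norm_eq_abs, abs_of_nonneg (by positivity)]
    exact Real.rpow_le_one (abs_nonneg _) (hg t ⟨ht.1, lt_of_le_of_ne ht.2 hne⟩) hq
  rw [one_mul, sub_zero, abs_of_nonneg hε] at h
  exact (le_abs_self _).trans h

theorem scaled_tsum_le (hd : 2 ≤ d) (hε : 0 < ε) (hε1 : ε ≤ 1 / 4) {I : Edge d → ℝ}
    (h0 : ∀ e ∉ nearEdges d ε, I e = 0) (h1 : ∀ e, I e ≤ ε) :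
    ε ^ (d - 1) * ∑' e, I e ≤ d * 5 ^ d := by
  rw [tsum_eq_sum fun e he => h0 e he]
  calc ε ^ (d - 1) * ∑ e ∈ nearEdges d ε, I e
      ≤ ε ^ (d - 1) * ((d * (5 / ε) ^ d) * ε) := by
        gcongr
        refine (Finset.sum_le_card_nsmul _ _ ε fun e _ => h1 e).trans ?_
        rw [nsmul_eq_mul]
        gcongr
        exact card_nearEdges_le hε hε1
    _ = d * (5 / ε) ^ d * ε ^ (d - 1 + 1) := by ring
    _ = d * 5 ^ d := by
        rw [Nat.sub_add_cancel (by omega : 1 ≤ d), div_pow]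
        field_simp

theorem lpNormPow_tent_le (hd : 2 ≤ d) (hε : 0 < ε) (hε1 : ε ≤ 1 / 4) {q : ℝ} (hq : 0 < q) :
    ε ^ (d - 1) * lpNormPow q (tent d ε) ≤ d * 5 ^ d :=
  scaled_tsum_le hd hε hε1 (fun _ he => integral_tent_eq_zero hε hε1 hq he)
    fun e => integral_rpow_le_of_abs_le_one hε.le (fun t _ => abs_onEdge_tent_le e t) hq.le

theorem derivNormSq_tent_le (hd : 2 ≤ d) (hε : 0 < ε) (hε1 : ε ≤ 1 / 4) :
    ε ^ (d - 1) * derivNormSq (tent d ε) ≤ d * 5 ^ d :=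
  scaled_tsum_le hd hε hε1 (fun _ he => integral_deriv_tent_eq_zero hε hε1 he)
    fun e => integral_rpow_le_of_abs_le_one hε.le (fun _ ht => abs_deriv_onEdge_tent_le e ht)
      (by norm_num)

theorem le_lpNormPow_tent (hd : 2 ≤ d) (hε : 0 < ε) (hε1 : ε ≤ 1 / 4) {q : ℝ} (hq : 0 < q) :
    (1 / 2) ^ q * (1 / (4 * d)) ^ d ≤ ε ^ (d - 1) * lpNormPow q (tent d ε) := by
  have hd1 : (1 : ℝ) ≤ d := by exact_mod_cast (by omega : 1 ≤ d)
  -- Vertices with coordinates in `[0, 1/(4d)]` have norm at most `1/4`; an edge adds at most `ε ≤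
  -- 1/4`, so the tent is at least `1/2` there. Counting from `0` gives `M + 1` values per
  -- coordinate, which compensates the floor.
  set M : ℕ := ⌊1 / (4 * d * ε)⌋₊ with hM
  set T : Finset (Edge d) :=
    Finset.Icc (fun _ => (0 : ℤ)) (fun _ => (M : ℤ)) ×ˢ {(⟨0, by omega⟩ : Fin d)} with hT
  have hcard : (1 / (4 * d * ε)) ^ d ≤ (T.card : ℝ) := by
    have : T.card = (M + 1) ^ d := by
      rw [hT, Finset.card_product, Pi.card_Icc]
      simp
    rw [this]
    push_cast
    gcongr
    exact (Nat.lt_floor_add_one _).le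
  have hI : ∀ e ∈ T, ε * (1 / 2) ^ q ≤ ∫ t in (0 : ℝ)..ε, |onEdge (tent d ε) e t| ^ q := by
    intro e he
    have he' := Finset.mem_Icc.1 (Finset.mem_product.1 he).1
    have hnorm0 : ‖edgePoint ε e 0‖ ≤ 1 / 4 := by
      refine abs_le_of_sq_le_sq' ?_ (by norm_num) |>.2
      rw [EuclideanSpace.norm_sq_eq]
      calc ∑ j, ‖edgePoint ε e 0 j‖ ^ 2 ≤ ∑ _j : Fin d, (1 / (4 * d : ℝ)) ^ 2 := by
            refine Finset.sum_le_sum fun j _ => ?_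
            gcongr
            have h0 : (0 : ℝ) ≤ e.1 j := by exact_mod_cast he'.1 j
            have h1 : (e.1 j : ℝ) ≤ 1 / (4 * d * ε) := by
              calc (e.1 j : ℝ) ≤ M := by exact_mod_cast he'.2 j
                _ ≤ _ := Nat.floor_le (by positivity)
            have h2 : edgePoint ε e 0 j = ε * e.1 j := by simp [edgePoint]
            rw [h2, Real.norm_eq_abs, abs_of_nonneg (by positivity)]
            calc ε * e.1 j ≤ ε * (1 / (4 * d * ε)) := by gcongr
              _ = _ := by field_simp
        _ = (1 / 4) ^ 2 * (1 / d) := by simp; field_simp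
        _ ≤ (1 / 4) ^ 2 * 1 := by
            gcongr
            rw [div_le_one (by linarith)]; exact hd1
        _ = _ := by ring
    have hpt : ∀ t ∈ Icc 0 ε, (1 / 2) ^ q ≤ |onEdge (tent d ε) e t| ^ q := by
      intro t ht
      refine Real.rpow_le_rpow (by norm_num) ?_ hq.le
      rw [onEdge_tent e ht]
      refine le_trans ?_ (le_abs_self _)
      refine le_max_of_le_right ?_
      have h3 := norm_sub_norm_le (edgePoint ε e t) (edgePoint ε e 0)
      rw [norm_edgePoint_sub, sub_zero, abs_of_nonneg ht.1] at h3
      linarith [ht.2]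
    have hint : IntervalIntegrable (fun t => |onEdge (tent d ε) e t| ^ q) volume 0 ε :=
      ((absolutelyContinuous_tent hε.le e).continuousOn.abs.rpow_const
        fun _ _ => Or.inr hq.le).intervalIntegrable
    have := intervalIntegral.integral_mono_on hε.le
      (intervalIntegrable_const (c := ((1 : ℝ) / 2) ^ q)) hint hpt
    simpa using this
  have hsum : T.card * (ε * (1 / 2) ^ q) ≤ lpNormPow q (tent d ε) := by
    rw [← nsmul_eq_mul]
    refine (Finset.card_nsmul_le_sum _ _ _ hI).trans ?_
    exact (summable_tent hε hε1 hq).sum_le_tsum T fun e _ =>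
      intervalIntegral.integral_nonneg hε.le fun t _ => by positivity
  calc (1 / 2) ^ q * (1 / (4 * d)) ^ d
      = (1 / 2) ^ q * (1 / (4 * d * ε)) ^ d * ε ^ (d - 1 + 1) := by
        rw [Nat.sub_add_cancel (by omega : 1 ≤ d), mul_assoc, ← mul_pow]
        congr 2; field_simp
    _ = ε ^ (d - 1) * ((1 / (4 * d * ε)) ^ d * (ε * (1 / 2) ^ q)) := by ring
    _ ≤ ε ^ (d - 1) * (T.card * (ε * (1 / 2) ^ q)) := by gcongr
    _ ≤ _ := by gcongr

/-- The Nehari manifold contains functions with bounded scaled `L^p` norm. -/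
theorem exists_mem_nehari_lpNormPow_le (hd : 2 ≤ d) {p ω : ℝ} (hp : 2 < p) (hω : 0 < ω) :
    ∃ C : ℝ, ∀ ε : ℝ, 0 < ε → ε ≤ 1 / 4 → ∃ v ∈ nehari d ε p ω,
      ε ^ (d - 1) * lpNormPow p v ≤ C := by
  have hd0 : (0 : ℝ) < d := by exact_mod_cast (by omega : 0 < d)
  set E : ℝ := d * 5 ^ d
  set c : ℝ → ℝ := fun q => (1 / 2) ^ q * (1 / (4 * d)) ^ d with hc
  have hcpos : ∀ q, 0 < c q := fun q => by positivity
  refine ⟨(((d * E + ω * E) / c p) ^ (1 / (p - 2))) ^ p * E, fun ε hε hε1 => ?_⟩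
  have ha : 0 < ε ^ (d - 1) := by positivity
  have hP := le_lpNormPow_tent hd hε hε1 (by linarith : 0 < p)
  have hB := le_lpNormPow_tent hd hε hε1 two_pos
  have hP0 : 0 < lpNormPow p (tent d ε) := pos_of_mul_pos_right ((hcpos p).trans_le hP) ha.le
  have hB0 : 0 < lpNormPow 2 (tent d ε) := pos_of_mul_pos_right ((hcpos 2).trans_le hB) ha.le
  have hA0 : 0 ≤ derivNormSq (tent d ε) := tsum_nonneg fun e =>
    intervalIntegral.integral_nonneg hε.le fun t _ => by positivity
  set D := (d : ℝ) * derivNormSq (tent d ε) + ω * lpNormPow 2 (tent d ε) with hD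
  have hD0 : 0 < D := by positivity
  have hne : tent d ε ≠ 0 := fun h => hP0.ne' (by
    simp [h, lpNormPow, onEdge, Real.zero_rpow (by linarith : p ≠ 0)])
  refine ⟨_, const_mul_mem_nehari hp (memH1_tent hε hε1) hne hD0 hP0, ?_⟩
  rw [lpNormPow_const_mul (by positivity), mul_left_comm]
  have hp2 : 0 ≤ 1 / (p - 2) := by
    have : 0 < p - 2 := by linarith
    positivity
  have hE := lpNormPow_tent_le hd hε hε1 (by linarith : 0 < p)
  refine mul_le_mul (Real.rpow_le_rpow (by positivity)
    (Real.rpow_le_rpow (by positivity) ?_ hp2) (by linarith)) hE (by positivity) (by positivity)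
  -- The projection factor depends on a ratio of norms, so both may be scaled by `ε^(d-1)`.
  rw [← mul_div_mul_left _ _ ha.ne']
  have hDE : ε ^ (d - 1) * D ≤ d * E + ω * E := by
    have h1 := derivNormSq_tent_le hd hε hε1
    have h2 := lpNormPow_tent_le hd hε hε1 two_pos
    calc ε ^ (d - 1) * D = d * (ε ^ (d - 1) * derivNormSq (tent d ε)) +
          ω * (ε ^ (d - 1) * lpNormPow 2 (tent d ε)) := by rw [hD]; ring
      _ ≤ _ := by gcongr
  exact div_le_div₀ (by positivity) hDE (hcpos p) hP

/-! ### Bounds for ground states -/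

/-- Bounds for nonnegative `A`, `B`, `P` linked by a Nehari identity and a
Gagliardo-Nirenberg inequality. -/
theorem bounds_of_gagliardo_nirenberg {δ ω K α β C₀ : ℝ} (hδ : 0 < δ) (hω : 0 < ω) (hK : 0 < K)
    (hα : 0 < α) (hβ : 0 < β) (hαβ : 1 < α + β) :
    ∃ C : ℝ, 0 < C ∧ ∀ A B P : ℝ, 0 ≤ A → 0 ≤ B → 0 < P → P ≤ C₀ → δ * A + ω * B = P →
      P ≤ K * A ^ α * B ^ β →
      (1 / C ≤ A ∧ A ≤ C) ∧ (1 / C ≤ B ∧ B ≤ C) ∧ (1 / C ≤ P ∧ P ≤ C) := by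
  -- `C₀` carries no sign assumption.
  set C₁ := max C₀ 1
  have hC₁ : 0 < C₁ := by positivity
  set L := K * (1 / δ) ^ α * (1 / ω) ^ β with hL
  have hL0 : 0 < L := by positivity
  -- The lower bound on `P` forced by `P ≤ L P^(α+β)`; `a` and `b` then solve `c ≤ K A^α B^β` with
  -- the other variable at its upper bound.
  set c := (1 / L) ^ (1 / (α + β - 1)) with hc
  have hc0 : 0 < c := by positivity
  set a := (c / (K * (C₁ / ω) ^ β)) ^ (1 / α) with ha
  set b := (c / (K * (C₁ / δ) ^ α)) ^ (1 / β) with hb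
  have ha0 : 0 < a := by positivity
  have hb0 : 0 < b := by positivity
  refine ⟨C₁ + C₁ / δ + C₁ / ω + 1 / a + 1 / b + 1 / c, by positivity, ?_⟩
  intro A B P hA hB hP hPC hN hGN
  have hPC₁ : P ≤ C₁ := hPC.trans (le_max_left _ _)
  have hAP : A ≤ 1 / δ * P := by
    rw [one_div_mul_eq_div, le_div_iff₀ hδ]; nlinarith
  have hBP : B ≤ 1 / ω * P := by
    rw [one_div_mul_eq_div, le_div_iff₀ hω]; nlinarith
  have hAC : A ≤ C₁ / δ := hAP.trans (by rw [one_div_mul_eq_div]; gcongr)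
  have hBC : B ≤ C₁ / ω := hBP.trans (by rw [one_div_mul_eq_div]; gcongr)
  have hcP : c ≤ P := by
    have h1 : P ≤ L * P ^ (α + β) := by
      calc P ≤ K * A ^ α * B ^ β := hGN
        _ ≤ K * (1 / δ * P) ^ α * (1 / ω * P) ^ β := by gcongr
        _ = _ := by
          rw [Real.mul_rpow (by positivity) hP.le, Real.mul_rpow (by positivity) hP.le,
            Real.rpow_add hP, hL]
          ring
    have h2 : 1 / L ≤ P ^ (α + β - 1) := by
      rw [Real.rpow_sub_one hP.ne', div_le_div_iff₀ hL0 hP]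
      linarith
    calc c ≤ (P ^ (α + β - 1)) ^ (1 / (α + β - 1)) := by
          rw [hc]
          exact Real.rpow_le_rpow (by positivity) h2 (one_div_nonneg.2 (by linarith))
      _ = P := by
          rw [← Real.rpow_mul hP.le, mul_one_div_cancel (by linarith), Real.rpow_one]
  have haA : a ≤ A := by
    have h1 : c / (K * (C₁ / ω) ^ β) ≤ A ^ α := by
      rw [div_le_iff₀ (by positivity)]
      calc c ≤ K * A ^ α * B ^ β := hcP.trans hGN
        _ ≤ K * A ^ α * (C₁ / ω) ^ β := by gcongr
        _ = _ := by ring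
    calc a ≤ (A ^ α) ^ (1 / α) := Real.rpow_le_rpow (by positivity) h1 (by positivity)
      _ = A := by rw [← Real.rpow_mul hA, mul_one_div_cancel hα.ne', Real.rpow_one]
  have hbB : b ≤ B := by
    have h1 : c / (K * (C₁ / δ) ^ α) ≤ B ^ β := by
      rw [div_le_iff₀ (by positivity)]
      calc c ≤ K * A ^ α * B ^ β := hcP.trans hGN
        _ ≤ K * (C₁ / δ) ^ α * B ^ β := by gcongr
        _ = _ := by ring
    calc b ≤ (B ^ β) ^ (1 / β) := Real.rpow_le_rpow (by positivity) h1 (by positivity)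
      _ = B := by rw [← Real.rpow_mul hB, mul_one_div_cancel hβ.ne', Real.rpow_one]
  have p1 : 0 < C₁ / δ := by positivity
  have p2 : 0 < C₁ / ω := by positivity
  have p3 : 0 < 1 / a := by positivity
  have p4 : 0 < 1 / b := by positivity
  have p5 : 0 < 1 / c := by positivity
  have hlow : ∀ x y : ℝ, 0 < x → x ≤ y → 1 / x ≤ C₁ + C₁ / δ + C₁ / ω + 1 / a + 1 / b + 1 / c →
      1 / (C₁ + C₁ / δ + C₁ / ω + 1 / a + 1 / b + 1 / c) ≤ y := fun x y hx hxy h =>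
    ((one_div_le (by positivity) hx).2 h).trans hxy
  refine ⟨⟨hlow a A ha0 haA ?_, ?_⟩, ⟨hlow b B hb0 hbB ?_, ?_⟩, hlow c P hc0 hcP ?_, ?_⟩ <;>
    linarith

/-- The `L^2` norm of a nonzero function in `H^1` is positive. -/
theorem lpNormPow_two_pos (hε : 0 < ε) {u : grid d ε → ℝ} (hu : MemH1 u) (h0 : u ≠ 0) :
    0 < lpNormPow 2 u := by
  have hnn : ∀ e : Edge d, 0 ≤ ∫ t in (0 : ℝ)..ε, |onEdge u e t| ^ (2 : ℝ) := fun e =>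
    intervalIntegral.integral_nonneg hε.le fun t _ => by positivity
  obtain ⟨⟨x, e, t, ht, rfl⟩, hx⟩ := Function.ne_iff.1 h0
  refine hu.summable_sq.tsum_pos hnn e ?_
  have hcont : ContinuousOn (fun t => |onEdge u e t| ^ (2 : ℝ)) (Icc 0 ε) := by
    have := (hu.absolutelyContinuous e).continuousOn.abs.rpow_const (p := 2)
      fun _ _ => Or.inr (by norm_num)
    rwa [uIcc_of_le hε.le] at this
  refine intervalIntegral.integral_pos hε hcont (fun t _ => by positivity) ⟨t, ht, ?_⟩
  have : onEdge u e t ≠ 0 := by rw [onEdge_of_mem u e ht]; exact hx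
  positivity

end CubicGrid

end

theorem theorem5p1 (d : ℕ) (hd : 2 ≤ d) (p : ℝ) (hp : 2 < p)
    (hp' : (p : EReal) < CubicGrid.criticalExponent d) (ω : ℝ) (hω : 0 < ω) :
    ∃ εbar : ℝ, 0 < εbar ∧ ∃ C : ℝ, 0 < C ∧
      ∀ ε : ℝ, 0 < ε → ε < εbar →
        ∀ u : CubicGrid.grid d ε → ℝ, CubicGrid.IsGroundState p ω u →
          (1 / C ≤ ε ^ (d - 1) * CubicGrid.derivNormSq u ∧
            ε ^ (d - 1) * CubicGrid.derivNormSq u ≤ C) ∧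
          (1 / C ≤ ε ^ (d - 1) * CubicGrid.lpNormPow 2 u ∧
            ε ^ (d - 1) * CubicGrid.lpNormPow 2 u ≤ C) ∧
          (1 / C ≤ ε ^ (d - 1) * CubicGrid.lpNormPow p u ∧
            ε ^ (d - 1) * CubicGrid.lpNormPow p u ≤ C) := by
  have hd0 : (0 : ℝ) < d := by exact_mod_cast (by omega : 0 < d)
  obtain ⟨K, α, β, hK, hα, hβ, hαβ, hGN⟩ := CubicGrid.gagliardo_nirenberg hd hp hp'
  obtain ⟨C₀, hC₀⟩ := CubicGrid.exists_mem_nehari_lpNormPow_le hd hp hω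
  obtain ⟨C, hC, hbounds⟩ := CubicGrid.bounds_of_gagliardo_nirenberg (C₀ := C₀) hd0 hω hK hα hβ hαβ
  -- The threshold `1/4` comes from the tent alone; the interpolation inequality holds for every `ε
  -- > 0`.
  refine ⟨1 / 4, by norm_num, C, hC, fun ε hε hε1 u hu => ?_⟩
  obtain ⟨v, hv, hvC⟩ := hC₀ ε hε hε1.le
  obtain ⟨huH, hu0, huN⟩ := hu.1
  have ha : 0 < ε ^ (d - 1) := by positivity
  have hA : 0 ≤ CubicGrid.derivNormSq u := tsum_nonneg fun e =>
    intervalIntegral.integral_nonneg hε.le fun t _ => by positivity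
  have hB := CubicGrid.lpNormPow_two_pos hε huH hu0
  refine hbounds _ _ _ (by positivity) (by positivity) ?_ ?_ ?_ (hGN ε hε u huH)
  · rw [← huN]; positivity
  · exact (mul_le_mul_of_nonneg_left (hu.lpNormPow_le hd hε hp hv) ha.le).trans hvC
  · rw [← huN]; ring
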